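/- Let $G$ be a group with a BN-pair $(B,N)$: that is, $B,N$ are subgroups generating $G$, $T=B\cap N$ is normal in $N$, and $\mathcal W=N/T$ is generated by a set $S$ of elements with $s^2=1$ such that $BwB\cdot BsB\subseteq BwB\cup BwsB$ and $sBs^{-1}\not\subseteq B$ for all $s\in S$, $w\in\mathcal W$. Assume that $S$ is finite and that $B$ is commensurated, i.e. $gBg^{-1}\sim_f B$ for all $g\in G$, where for subgroups $H,K$ of a group we write $H\sim_f K$ if $H\cap K$ has finite index in both $H$ and $K$; we say that $H$ is virtually contained in $K$ if $H\cap K$ has finite index in $H$. For $J\subseteq S$ let $\mathcal W_J=\langle J\rangle$ and let $P_J=B\mathcal W_JB$ be the standard parabolic subgroup of $G$ of type $J$. Let $\Lambda^\infty_{(\mathcal W,S)}$ be the quotient by $\sim_f$ of the poset of subgroups $\mathcal W_J$ ($J\subseteq S$) ordered by inclusion, with the order generated by inclusions between representatives, and let $[\mathcal W_J]$ be the class of $\mathcal W_J$ in it. Let $J,J'\subseteq S$. 1. If $g\in G$ is such that $gP_Jg^{-1}$ is virtually contained in $P_{J'}$, then $[\mathcal W_J]\le[\mathcal W_{J'}]$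 in $\Lambda^\infty_{(\mathcal W,S)}$; moreover $[\mathcal W_J]=[\mathcal W_{J'}]$ if and only if $gP_Jg^{-1}\sim_f P_{J'}$. 2. Conversely, if $[\mathcal W_J]\le[\mathcal W_{J'}]$, then $P_J$ is virtually contained in $P_{J'}$. -/

import Mathlib

open scoped Pointwise

/-- `H` is virtually contained in `K` if `H ⊓ K` has finite index in `H`. -/
def VirtuallyContained {G : Type*} [Group G] (H K : Subgroup G) : Prop :=
  ((H ⊓ K).subgroupOf H).FiniteIndex

/-- `B` is commensurated in `G` if `g B g⁻¹ ∼_f B` for all `g : G`. -/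
def IsCommensurated {G : Type*} [Group G] (B : Subgroup G) : Prop :=
  ∀ g : G, Subgroup.Commensurable (ConjAct.toConjAct g • B) B

section StandardParabolics

variable {W : Type*} [Group W]

/-- The set of standard parabolic subgroups `W_J = ⟨J⟩`, `J ⊆ S`, of `(W, S)`. -/
def StdParabolic (S : Set W) : Type _ :=
  {H : Subgroup W // ∃ J ⊆ S, Subgroup.closure J = H}

/-- Standard parabolic subgroups are ordered by inclusion. -/
instance (S : Set W) : PartialOrder (StdParabolic S) :=
  inferInstanceAs (PartialOrder {H : Subgroup W // ∃ J ⊆ S, Subgroup.closure J = H})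

/-- The standard parabolic subgroup `W_J`. -/
def StdParabolic.of {S : Set W} (J : Set S) : StdParabolic S :=
  ⟨Subgroup.closure (Subtype.val '' J), _, Subtype.coe_image_subset S J, rfl⟩

/-- The relation `∼_f` on standard parabolic subgroups. -/
instance StdParabolic.setoid (S : Set W) : Setoid (StdParabolic S) where
  r H K := Subgroup.Commensurable H.1 K.1
  iseqv := ⟨fun _ => .refl _, fun h => h.symm, fun h h' => h.trans h'⟩

/-- Standard parabolic subgroups of `(W, S)` modulo `∼_f`. -/
def StdParabolicModFinite (S : Set W) : Type _ :=
  Quotient (StdParabolic.setoid S)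

namespace StdParabolicModFinite

variable {S : Set W}

/-- The class `[H]` of a standard parabolic subgroup `H`. -/
def mk (H : StdParabolic S) : StdParabolicModFinite S := Quotient.mk _ H

/-- The relation that inclusion of standard parabolic subgroups induces on classes. -/
def InducedLE (a b : StdParabolicModFinite S) : Prop :=
  ∃ H K : StdParabolic S, mk H = a ∧ mk K = b ∧ H ≤ K

theorem relIndex_ne_zero_of_transGen (H K : StdParabolic S)
    (h : Relation.TransGen InducedLE (mk H) (mk K)) : K.1.relIndex H.1 ≠ 0 := by
  have key : ∀ b, Relation.TransGen InducedLE (mk H) b →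
      ∀ K : StdParabolic S, mk K = b → K.1.relIndex H.1 ≠ 0 := by
    have step : ∀ H K : StdParabolic S, InducedLE (mk H) (mk K) → K.1.relIndex H.1 ≠ 0 := by
      rintro H K ⟨H', K', hH, hK, hle⟩
      have h1 : Subgroup.Commensurable H'.1 H.1 := Quotient.exact hH
      have h2 : Subgroup.Commensurable K'.1 K.1 := Quotient.exact hK
      have h3 : K'.1.relIndex H'.1 ≠ 0 := by
        rw [Subgroup.relIndex_eq_one.2 (show H'.1 ≤ K'.1 from hle)]
        exact one_ne_zero
      exact Subgroup.relIndex_ne_zero_trans h2.2 (Subgroup.relIndex_ne_zero_trans h3 h1.1)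
    intro b hb
    induction hb with
    | single h => rintro K rfl; exact step _ _ h
    | @tail b c _ h ih =>
      rintro K rfl
      obtain ⟨L, rfl⟩ : ∃ L, mk L = b := Quotient.exists_rep b
      exact Subgroup.relIndex_ne_zero_trans (step _ _ h) (ih L rfl)
  exact key _ h K rfl

/-- The quotient order: the partial order on classes generated by the relation that inclusion
induces. For a Coxeter system the induced relation is already transitive. -/
instance : PartialOrder (StdParabolicModFinite S) where
  le := Relation.TransGen InducedLE
  le_refl a := by
    obtain ⟨H, rfl⟩ : ∃ H, mk H = a := Quotient.exists_rep a
    exact .single ⟨H, H, rfl, rfl, le_rfl⟩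
  le_trans _ _ _ h h' := h.trans h'
  le_antisymm a b h h' := by
    obtain ⟨H, rfl⟩ : ∃ H, mk H = a := Quotient.exists_rep a
    obtain ⟨K, rfl⟩ : ∃ K, mk K = b := Quotient.exists_rep b
    exact Quotient.sound
      ⟨relIndex_ne_zero_of_transGen K H h', relIndex_ne_zero_of_transGen H K h⟩

end StdParabolicModFinite

end StandardParabolics

section BNPairs

variable {G : Type*} [Group G]

/-- The underlying type of `N / T`, where `T = B ∩ N`. -/
abbrev WeylQuotient (B N : Subgroup G) : Type _ := N ⧸ B.subgroupOf N

/-- The union of the cosets `w = nT ⊆ N ⊆ G` for `w` in a subset `A` of `N / T`. -/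
def weylLift (B N : Subgroup G) (A : Set (WeylQuotient B N)) : Set G :=
  {g | ∃ n : N, (QuotientGroup.mk n : WeylQuotient B N) ∈ A ∧ (n : G) = g}

/-- The set `B A B ⊆ G`, for a subset `A` of `N / T`. -/
def bruhatCells (B N : Subgroup G) (A : Set (WeylQuotient B N)) : Set G :=
  (B : Set G) * weylLift B N A * (B : Set G)

/-- The double coset `B w B` for `w` in `N / T`. -/
def bruhatCell (B N : Subgroup G) (w : WeylQuotient B N) : Set G :=
  bruhatCells B N {w}

end BNPairs

/-- A BN-pair `(B, N)` in `G`, with its set `S` of generators of `W = N / (B ∩ N)`: these are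
involutions with `BwB · BsB ⊆ BwB ∪ BwsB` and `sBs⁻¹ ⊄ B`. -/
structure BNPair (G : Type*) [Group G] where
  B : Subgroup G
  N : Subgroup G
  sup_eq_top : B ⊔ N = ⊤
  [normal_T : (B.subgroupOf N).Normal]
  S : Set (WeylQuotient B N)
  closure_S : Subgroup.closure S = ⊤
  mul_self_of_mem : ∀ s ∈ S, s * s = 1
  cell_mul_subset : ∀ s ∈ S, ∀ w : WeylQuotient B N,
    bruhatCell B N w * bruhatCell B N s ⊆ bruhatCell B N w ∪ bruhatCell B N (w * s)
  not_conj_le : ∀ n : N, (QuotientGroup.mk n : WeylQuotient B N) ∈ S →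
    ¬ (ConjAct.toConjAct (n : G) • B ≤ B)

namespace BNPair

variable {G : Type*} [Group G] (P : BNPair G)

instance : (P.B.subgroupOf P.N).Normal := P.normal_T

/-- The Weyl group `N / (B ∩ N)`. -/
abbrev Weyl : Type _ := WeylQuotient P.B P.N

/-- The class `[W_J]` modulo `∼_f` of the standard parabolic subgroup `W_J = ⟨J⟩`. -/
def weylClass (J : Set P.S) : StdParabolicModFinite P.S :=
  .mk (.of J)

theorem mem_bruhatCells {A : Set P.Weyl} {g : G} :
    g ∈ bruhatCells P.B P.N A ↔
      ∃ b ∈ P.B, ∃ n : P.N, (QuotientGroup.mk n : P.Weyl) ∈ A ∧ ∃ b' ∈ P.B, b * n * b' = g := by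
  constructor
  · rintro ⟨_, ⟨b, hb, _, ⟨n, hn, rfl⟩, rfl⟩, b', hb', rfl⟩
    exact ⟨b, hb, n, hn, b', hb', rfl⟩
  · rintro ⟨b, hb, n, hn, b', hb', rfl⟩
    exact ⟨_, ⟨b, hb, _, ⟨n, hn, rfl⟩, rfl⟩, b', hb', rfl⟩

theorem bruhatCells_mul_rep (J : Set P.S) (n : P.N)
    (hn : (QuotientGroup.mk n : P.Weyl) ∈ Subgroup.closure (Subtype.val '' J)) :
    ∀ x ∈ bruhatCells P.B P.N (Subgroup.closure (Subtype.val '' J) : Subgroup P.Weyl),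
      x * n ∈ bruhatCells P.B P.N (Subgroup.closure (Subtype.val '' J) : Subgroup P.Weyl) := by
  have hgen : ∀ s ∈ Subtype.val '' J, ∀ m : P.N, (QuotientGroup.mk m : P.Weyl) = s →
      ∀ x ∈ bruhatCells P.B P.N (Subgroup.closure (Subtype.val '' J) : Subgroup P.Weyl),
        x * m ∈ bruhatCells P.B P.N (Subgroup.closure (Subtype.val '' J) : Subgroup P.Weyl) := by
    rintro s hs m hm x hx
    have hsS : s ∈ P.S := Subtype.coe_image_subset _ _ hs
    obtain ⟨b, hb, k, hk, b', hb', rfl⟩ := P.mem_bruhatCells.1 hx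
    have h1 : b * k * b' ∈ bruhatCell P.B P.N (QuotientGroup.mk k : P.Weyl) :=
      P.mem_bruhatCells.2 ⟨b, hb, k, rfl, b', hb', rfl⟩
    have h2 : (m : G) ∈ bruhatCell P.B P.N s :=
      P.mem_bruhatCells.2 ⟨1, one_mem _, m, hm, 1, one_mem _, by simp⟩
    rcases P.cell_mul_subset s hsS _ (Set.mul_mem_mul h1 h2) with h | h
    · obtain ⟨c, hc, l, hl, c', hc', e⟩ := P.mem_bruhatCells.1 h
      refine P.mem_bruhatCells.2 ⟨c, hc, l, ?_, c', hc', e⟩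
      rw [Set.mem_singleton_iff.1 hl]; exact hk
    · obtain ⟨c, hc, l, hl, c', hc', e⟩ := P.mem_bruhatCells.1 h
      refine P.mem_bruhatCells.2 ⟨c, hc, l, ?_, c', hc', e⟩
      rw [Set.mem_singleton_iff.1 hl]
      exact mul_mem hk (Subgroup.subset_closure hs)
  suffices H : ∀ w ∈ Subgroup.closure (Subtype.val '' J), ∀ m : P.N,
      (QuotientGroup.mk m : P.Weyl) = w →
      ∀ x ∈ bruhatCells P.B P.N (Subgroup.closure (Subtype.val '' J) : Subgroup P.Weyl),
        x * m ∈ bruhatCells P.B P.N (Subgroup.closure (Subtype.val '' J) : Subgroup P.Weyl) from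
    H _ hn n rfl
  intro w hw
  have hmul : ∀ u : P.Weyl, (∀ m : P.N, (QuotientGroup.mk m : P.Weyl) = u →
      ∀ x ∈ bruhatCells P.B P.N (Subgroup.closure (Subtype.val '' J) : Subgroup P.Weyl),
        x * m ∈ bruhatCells P.B P.N (Subgroup.closure (Subtype.val '' J) : Subgroup P.Weyl)) →
      ∀ s ∈ Subtype.val '' J, ∀ m : P.N, (QuotientGroup.mk m : P.Weyl) = u * s →
      ∀ x ∈ bruhatCells P.B P.N (Subgroup.closure (Subtype.val '' J) : Subgroup P.Weyl),
        x * m ∈ bruhatCells P.B P.N (Subgroup.closure (Subtype.val '' J) : Subgroup P.Weyl) := by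
    intro u hu s hs m hm x hx
    obtain ⟨p, rfl⟩ := QuotientGroup.mk_surjective u
    have h1 := hgen s hs (p⁻¹ * m)
      (by rw [QuotientGroup.mk_mul, hm, QuotientGroup.mk_inv]; group) _ (hu p rfl x hx)
    simpa [mul_assoc] using h1
  induction hw using Subgroup.closure_induction_right with
  | one =>
    intro m hm x hx
    have hmB : (m : G) ∈ P.B := by
      rw [QuotientGroup.eq_one_iff] at hm
      exact hm
    obtain ⟨b, hb, k, hk, b', hb', rfl⟩ := P.mem_bruhatCells.1 hx
    exact P.mem_bruhatCells.2 ⟨b, hb, k, hk, b' * m, mul_mem hb' hmB, by group⟩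
  | mul_right u _ s hs hu => exact hmul u hu s hs
  | mul_inv_cancel u _ s hs hu =>
    have hinv : s⁻¹ = s :=
      inv_eq_of_mul_eq_one_left (P.mul_self_of_mem s (Subtype.coe_image_subset _ _ hs))
    rw [hinv]
    exact hmul u hu s hs

/-- The standard parabolic subgroup `P_J = B W_J B` of `G`. -/
def parabolic (J : Set P.S) : Subgroup G where
  carrier := bruhatCells P.B P.N (StdParabolic.of J).1
  one_mem' := P.mem_bruhatCells.2
    ⟨1, one_mem _, 1, one_mem (StdParabolic.of J).1, 1, one_mem _, by simp⟩
  mul_mem' := by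
    intro x y hx hy
    obtain ⟨b, hb, n, hn, b', hb', rfl⟩ := P.mem_bruhatCells.1 hy
    obtain ⟨c, hc, k, hk, c', hc', rfl⟩ := P.mem_bruhatCells.1 hx
    have h1 := P.bruhatCells_mul_rep J n hn (c * k * (c' * b))
      (P.mem_bruhatCells.2 ⟨c, hc, k, hk, c' * b, mul_mem hc' hb, rfl⟩)
    obtain ⟨d, hd, l, hl, d', hd', e⟩ := P.mem_bruhatCells.1 h1
    refine P.mem_bruhatCells.2 ⟨d, hd, l, hl, d' * b', mul_mem hd' hb', ?_⟩
    rw [← mul_assoc, e]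
    group
  inv_mem' := by
    intro x hx
    obtain ⟨b, hb, n, hn, b', hb', rfl⟩ := P.mem_bruhatCells.1 hx
    exact P.mem_bruhatCells.2 ⟨b'⁻¹, inv_mem hb', n⁻¹, inv_mem hn, b⁻¹, inv_mem hb, by
      push_cast; group⟩

end BNPair

/-!
The theorem is first proved for the Weyl group `W`, and then transported to `G` by the Bruhat
decomposition.

*The Weyl group.* No Coxeter presentation is used, only the half-spaces
`H s = {w | sBw ⊆ BswB}` of `W` (`BNPair.halfSpace`). The axioms of a BN-pair imply that an edge of
the Cayley graph of `W` that leaves `H s` is reversed by `s`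
(`BNPair.isFoldingSystem`). A gallery that leaves `H s` therefore crosses the wall of `s`
(`IsFoldingSystem.exists_crossing`), which gives the exchange condition and, for `u` shortest in
`W_J u W_J'`, the description of `W_J ∩ u W_J' u⁻¹` as a standard parabolic subgroup
(`IsFoldingSystem.mem_closure_of_conj_mem`).

Since `S` is finite, `J` contains a set `K` with `W_K` of finite index in `W_J` that is rigid: no
proper subset of `K` generates a subgroup of finite index in `W_K`. Let a conjugate of `W_K` be
virtually contained in `W_J'`. Up to factors in `W_K` and `W_J'` the conjugating element is the
inverse of a shortest `u`, and rigidity gives `u⁻¹ K u ⊆ J'`. If `s` is the first letter of a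
reduced word of `u`, then all walls `x s x⁻¹` with `x ∈ W_K` separate `1` from `u`, so there are
only finitely many (`IsFoldingSystem.finite_conj_of_conj_subset`). Hence the centralizer of `s` in
`W_K`, which lies in the parabolic subgroup of type `K ∩ s K s⁻¹`, has finite index, and rigidity
forces `s` to commute with `K`. By induction all letters of `u` commute with `K`, so that
`K ⊆ J'` (`IsFoldingSystem.subset_of_relIndex_conj_ne_zero`).

*The group `G`.* As `N ∩ P_J` is the preimage of `W_J`, virtual containment of `gP_Jg⁻¹` in `P_J'`
implies virtual containment of a conjugate of `W_J` in `W_J'`. So `K ⊆ J'`, and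
`[W_J] = [W_K] ≤ [W_J']`. Conversely, as `B` is commensurated, every `BwP_J'` is a finite union of
cosets of `P_J'`, and virtual containment of `W_J` in `W_J'` implies that of `P_J` in `P_J'`.
Finally, if `[W_J] = [W_J']`, then `P_J`, `P_J'` and `P_K` are commensurable, and `g` is, up to
factors in `P_K`, a product of elements of `S` that commute with `K`. These lie in the commensurator
of `P_K` (`BNPair.mem_commensurator`), so `gP_Jg⁻¹` is commensurable with `P_J'`.
-/

/-! ### Folding systems -/

/-- A group `W` generated by a set `S` of involutions, with a subset `H s` of `W` for each `s ∈ S`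
that plays the role of the half-space bounded by the wall of `s` and containing `1`: it contains
`1`, is disjoint from its translate by `s`, and an edge `w, w * t` of the Cayley graph that leaves
it is reversed by `s`. This characterizes Coxeter systems without mentioning a presentation. -/
structure IsFoldingSystem {W : Type*} [Group W] (S : Set W) (H : W → Set W) : Prop where
  mul_self : ∀ s ∈ S, s * s = 1
  closure_eq_top : Subgroup.closure S = ⊤
  one_mem_half : ∀ s ∈ S, 1 ∈ H s
  mul_notMem : ∀ s ∈ S, ∀ w ∈ H s, s * w ∉ H s
  fold : ∀ s ∈ S, ∀ t ∈ S, ∀ w ∈ H s, w * t ∉ H s → s * w = w * t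

/-- The least length of a word in `S` with product `w` (zero if there is no such word). -/
noncomputable def wordLength {W : Type*} [Group W] (S : Set W) (w : W) : ℕ :=
  sInf {n | ∃ l : List W, (∀ t ∈ l, t ∈ S) ∧ l.prod = w ∧ l.length = n}

theorem wordLength_prod_le {W : Type*} [Group W] {S : Set W} {l : List W} (hl : ∀ t ∈ l, t ∈ S) :
    wordLength S l.prod ≤ l.length :=
  Nat.sInf_le ⟨l, hl, rfl, rfl⟩

theorem Subgroup.list_prod_mem_closure {W : Type*} [Group W] {J : Set W} {l : List W}
    (hl : ∀ t ∈ l, t ∈ J) : l.prod ∈ Subgroup.closure J :=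
  list_prod_mem fun t ht => Subgroup.subset_closure (hl t ht)

/-- In a subgroup generated by involutions, every element is the product of a word in these. -/
theorem exists_word_of_mul_self {W : Type*} [Group W] {J : Set W} (hJ : ∀ s ∈ J, s * s = 1)
    {w : W} (hw : w ∈ Subgroup.closure J) : ∃ l : List W, (∀ t ∈ l, t ∈ J) ∧ l.prod = w := by
  apply Submonoid.exists_list_of_mem_closure
  rw [← Subgroup.mem_toSubmonoid, Subgroup.closure_toSubmonoid] at hw
  have : J⁻¹ ⊆ J := fun t ht => by
    have h1 := inv_eq_of_mul_eq_one_left (hJ _ (Set.mem_inv.1 ht))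
    rw [inv_inv] at h1
    rw [h1]
    exact ht
  rwa [Set.union_eq_left.2 this] at hw

theorem exists_word_length_eq {W : Type*} [Group W] {S : Set W} (hS : ∀ s ∈ S, s * s = 1)
    (htop : Subgroup.closure S = ⊤) (w : W) :
    ∃ l : List W, (∀ t ∈ l, t ∈ S) ∧ l.prod = w ∧ l.length = wordLength S w := by
  obtain ⟨l, hl, e⟩ := exists_word_of_mul_self hS (w := w) (by simp [htop])
  exact Nat.sInf_mem (s := {n | ∃ l : List W, (∀ t ∈ l, t ∈ S) ∧ l.prod = w ∧ l.length = n})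
    ⟨_, l, hl, e, rfl⟩

theorem wordLength_mul_le_add_one {W : Type*} [Group W] {S : Set W} (hS : ∀ s ∈ S, s * s = 1)
    (htop : Subgroup.closure S = ⊤) {s : W} (hs : s ∈ S) (w : W) :
    wordLength S (s * w) ≤ wordLength S w + 1 := by
  obtain ⟨l, hl, rfl, e⟩ := exists_word_length_eq hS htop w
  have := wordLength_prod_le (S := S) (l := s :: l) (by simpa using ⟨hs, hl⟩)
  simpa [e] using this

namespace IsFoldingSystem

variable {W : Type*} [Group W] {S : Set W} {H : W → Set W}

theorem inv_eq (h : IsFoldingSystem S H) {s : W} (hs : s ∈ S) : s⁻¹ = s :=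
  inv_eq_of_mul_eq_one_left (h.mul_self s hs)

theorem mul_mul_cancel (h : IsFoldingSystem S H) {s : W} (hs : s ∈ S) (w : W) :
    s * (s * w) = w := by
  rw [← mul_assoc, h.mul_self s hs, one_mul]

theorem self_notMem (h : IsFoldingSystem S H) {s : W} (hs : s ∈ S) : s ∉ H s := by
  simpa using h.mul_notMem s hs 1 (h.one_mem_half s hs)

theorem ne_one (h : IsFoldingSystem S H) {s : W} (hs : s ∈ S) : s ≠ 1 := by
  rintro rfl
  exact h.self_notMem hs (h.one_mem_half 1 hs)

theorem eq_of_notMem (h : IsFoldingSystem S H) {s t : W} (hs : s ∈ S) (ht : t ∈ S)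
    (hts : t ∉ H s) : s = t := by
  simpa using h.fold s hs t ht 1 (h.one_mem_half s hs) (by simpa using hts)

theorem exists_word (h : IsFoldingSystem S H) {J : Set W} (hJ : J ⊆ S) {w : W}
    (hw : w ∈ Subgroup.closure J) : ∃ l : List W, (∀ t ∈ l, t ∈ J) ∧ l.prod = w :=
  exists_word_of_mul_self (fun s hs => h.mul_self s (hJ hs)) hw

/-- A gallery starting at `a` that leaves the half-space `H s` crosses the wall of `s`. -/
theorem exists_crossing (h : IsFoldingSystem S H) {s : W} (hs : s ∈ S) (l : List W)
    (hl : ∀ t ∈ l, t ∈ S) (a : W) (ha : a ∈ H s) (hal : a * l.prod ∉ H s) :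
    ∃ l₁ t l₂, l = l₁ ++ t :: l₂ ∧ s * (a * l₁.prod) = a * l₁.prod * t := by
  induction l generalizing a with
  | nil => exact absurd ha (by simpa using hal)
  | cons t l ih =>
    by_cases hat : a * t ∈ H s
    · obtain ⟨l₁, u, l₂, rfl, e⟩ := ih (fun x hx => hl x (List.mem_cons_of_mem _ hx)) (a * t) hat
        (by simpa [mul_assoc] using hal)
      exact ⟨t :: l₁, u, l₂, rfl, by simpa [mul_assoc] using e⟩
    · exact ⟨[], t, l, rfl, by simpa using h.fold s hs t (hl t (by simp)) a ha hat⟩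

/-- The exchange condition. -/
theorem exists_exchange (h : IsFoldingSystem S H) {s : W} (hs : s ∈ S) (l : List W)
    (hl : ∀ t ∈ l, t ∈ S) (hsl : l.prod ∉ H s) :
    ∃ l₁ t l₂, l = l₁ ++ t :: l₂ ∧ s * l.prod = (l₁ ++ l₂).prod := by
  obtain ⟨l₁, t, l₂, rfl, e⟩ := h.exists_crossing hs l hl 1 (h.one_mem_half s hs) (by simpa using hsl)
  refine ⟨l₁, t, l₂, rfl, ?_⟩
  have ht : t ∈ S := hl t (by simp)
  rw [one_mul] at e
  rw [List.prod_append, List.prod_cons, ← mul_assoc, e, mul_assoc, h.mul_mul_cancel ht,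
    List.prod_append]

theorem exists_reduced_word (h : IsFoldingSystem S H) (w : W) :
    ∃ l : List W, (∀ t ∈ l, t ∈ S) ∧ l.prod = w ∧ l.length = wordLength S w :=
  exists_word_length_eq h.mul_self h.closure_eq_top w

theorem wordLength_mul_le (h : IsFoldingSystem S H) {s : W} (hs : s ∈ S) (w : W) :
    wordLength S (s * w) ≤ wordLength S w + 1 :=
  wordLength_mul_le_add_one h.mul_self h.closure_eq_top hs w

theorem wordLength_mul_lt (h : IsFoldingSystem S H) {s : W} (hs : s ∈ S) {w : W} (hw : w ∉ H s) :
    wordLength S (s * w) < wordLength S w := by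
  obtain ⟨l, hl, rfl, e⟩ := h.exists_reduced_word w
  obtain ⟨l₁, t, l₂, rfl, e'⟩ := h.exists_exchange hs l hl hw
  rw [e', ← e]
  refine (wordLength_prod_le (l := l₁ ++ l₂) fun x hx => hl x ?_).trans_lt (by simp)
  simp only [List.mem_append, List.mem_cons] at hx ⊢
  tauto

theorem lt_wordLength_mul (h : IsFoldingSystem S H) {s : W} (hs : s ∈ S) {w : W} (hw : w ∈ H s) :
    wordLength S w < wordLength S (s * w) := by
  simpa [h.mul_mul_cancel hs] using h.wordLength_mul_lt hs (h.mul_notMem s hs w hw)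

theorem mul_mem_of_notMem (h : IsFoldingSystem S H) {s : W} (hs : s ∈ S) {w : W} (hw : w ∉ H s) :
    s * w ∈ H s := by
  by_contra hsw
  have h1 := h.wordLength_mul_lt hs hsw
  rw [h.mul_mul_cancel hs] at h1
  exact (h.wordLength_mul_lt hs hw).not_gt h1

theorem mul_mem_iff (h : IsFoldingSystem S H) {s : W} (hs : s ∈ S) {w : W} :
    s * w ∈ H s ↔ w ∉ H s :=
  ⟨fun h1 h2 => h.mul_notMem s hs w h2 h1, h.mul_mem_of_notMem hs⟩

theorem wordLength_inv (h : IsFoldingSystem S H) (w : W) :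
    wordLength S w⁻¹ = wordLength S w := by
  have key : ∀ w, wordLength S w⁻¹ ≤ wordLength S w := by
    intro w
    obtain ⟨l, hl, rfl, e⟩ := h.exists_reduced_word w
    rw [List.prod_inv_reverse, ← e]
    refine (wordLength_prod_le ?_).trans (by simp)
    intro t ht
    simp only [List.mem_reverse, List.mem_map] at ht
    obtain ⟨a, ha, rfl⟩ := ht
    rw [h.inv_eq (hl a ha)]
    exact hl a ha
  exact (key w).antisymm (by simpa using key w⁻¹)

/-- Induction on the elements of `⟨J⟩` along reduced words in `J`. -/
theorem closure_induction (h : IsFoldingSystem S H) {J : Set W} (hJ : J ⊆ S) {p : W → Prop}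
    (one : p 1)
    (mul : ∀ j ∈ J, ∀ w ∈ Subgroup.closure J, w ∈ H j → p w → p (j * w))
    {w : W} (hw : w ∈ Subgroup.closure J) : p w := by
  obtain ⟨l, hl, rfl⟩ := h.exists_word hJ hw
  clear hw
  induction hn : l.length using Nat.strong_induction_on generalizing l with
  | _ n ih =>
    subst hn
    cases l with
    | nil => simpa using one
    | cons j l =>
      have hj : j ∈ J := hl j (by simp)
      have hl' : ∀ t ∈ l, t ∈ J := fun t ht => hl t (by simp [ht])
      rw [List.prod_cons]
      by_cases hlj : l.prod ∈ H j
      · exact mul j hj _ (Subgroup.list_prod_mem_closure hl') hlj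
          (ih _ (by simp) l hl' rfl)
      · -- the word is not reduced: exchange gives a word of `l.length - 1` letters
        obtain ⟨l₁, t, l₂, rfl, e⟩ := h.exists_exchange (hJ hj) l (fun t ht => hJ (hl' t ht)) hlj
        rw [e]
        refine ih _ (by simp) (l₁ ++ l₂) (fun x hx => hl' x ?_) rfl
        simp only [List.mem_append, List.mem_cons] at hx ⊢
        tauto

theorem mem_of_mem_closure (h : IsFoldingSystem S H) {J : Set W} (hJ : J ⊆ S) {s : W}
    (hs : s ∈ S) (hsJ : s ∈ Subgroup.closure J) : s ∈ J := by
  refine h.closure_induction hJ (p := fun w => w ∈ S → w ∈ J)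
    (fun h1 => absurd rfl (h.ne_one h1)) ?_ hsJ hs
  intro j hj w _ hw _ hjw
  rwa [← h.eq_of_notMem (hJ hj) hjw (h.mul_notMem j (hJ hj) w hw)]

/-- A gallery of type `J` starting at `u` crosses only walls of reflections in `u⟨J⟩u⁻¹`, so it
stays in `H s` if `s` is not one of them. -/
theorem mul_mem_of_mem_closure (h : IsFoldingSystem S H) {J : Set W} (hJ : J ⊆ S) {s u y : W}
    (hs : s ∈ S) (hsu : u⁻¹ * s * u ∉ Subgroup.closure J) (hu : u ∈ H s)
    (hy : y ∈ Subgroup.closure J) : u * y ∈ H s := by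
  by_contra hn
  obtain ⟨l, hl, rfl⟩ := h.exists_word hJ hy
  obtain ⟨l₁, t, l₂, rfl, e⟩ := h.exists_crossing hs l (fun t ht => hJ (hl t ht)) u hu hn
  have h1 : l₁.prod ∈ Subgroup.closure J :=
    Subgroup.list_prod_mem_closure fun t ht => hl t (by simp [ht])
  have h2 : t ∈ Subgroup.closure J := Subgroup.subset_closure (hl t (by simp))
  apply hsu
  have : u⁻¹ * s * u = l₁.prod * t * l₁.prod⁻¹ := by
    rw [eq_mul_inv_iff_mul_eq]
    calc u⁻¹ * s * u * l₁.prod = u⁻¹ * (s * (u * l₁.prod)) := by group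
      _ = l₁.prod * t := by rw [e]; group
  rw [this]
  exact mul_mem (mul_mem h1 h2) (inv_mem h1)

/-! ### Reduced representatives and intersections of parabolic subgroups -/

/-- If `u` is shortest in `⟨J⟩u` and `x ∈ ⟨J⟩`, then `x` and `x * u` lie on the same side of
the walls of `J`: no gallery from `x` to `x * u` of minimal length crosses a wall of `⟨J⟩`. -/
theorem mul_mem_of_shortest (h : IsFoldingSystem S H) {J : Set W} (hJ : J ⊆ S) {u : W}
    (hu : ∀ a ∈ Subgroup.closure J, wordLength S u ≤ wordLength S (a * u)) {j x : W}
    (hj : j ∈ J) (hx : x ∈ Subgroup.closure J) (hxj : x ∈ H j) : x * u ∈ H j := by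
  by_contra hn
  obtain ⟨l, hl, rfl, e⟩ := h.exists_reduced_word u
  obtain ⟨l₁, t, l₂, rfl, e'⟩ := h.exists_crossing (hJ hj) l hl x hxj hn
  have ht : t ∈ S := hl t (by simp)
  -- the reflection `x⁻¹ * j * x` of `⟨J⟩` shortens `u`
  have h1 : x⁻¹ * j * x * (l₁ ++ t :: l₂).prod = (l₁ ++ l₂).prod := by
    rw [List.prod_append, List.prod_cons, List.prod_append]
    calc x⁻¹ * j * x * (l₁.prod * (t * l₂.prod))
        = x⁻¹ * (j * (x * l₁.prod)) * (t * l₂.prod) := by group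
      _ = l₁.prod * (t * (t * l₂.prod)) := by rw [e']; group
      _ = l₁.prod * l₂.prod := by rw [h.mul_mul_cancel ht]
  have h2 := hu (x⁻¹ * j * x)
    (mul_mem (mul_mem (inv_mem hx) (Subgroup.subset_closure hj)) hx)
  rw [h1, ← e] at h2
  have h3 : wordLength S (l₁ ++ l₂).prod ≤ (l₁ ++ l₂).length := wordLength_prod_le fun x hx => hl x
    (by simp only [List.mem_append, List.mem_cons] at hx ⊢; tauto)
  simp only [List.length_append, List.length_cons] at h2 h3
  omega

theorem mul_notMem_of_shortest (h : IsFoldingSystem S H) {J : Set W} (hJ : J ⊆ S) {u : W}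
    (hu : ∀ a ∈ Subgroup.closure J, wordLength S u ≤ wordLength S (a * u)) {j x : W}
    (hj : j ∈ J) (hx : x ∈ Subgroup.closure J) (hxj : x ∉ H j) : x * u ∉ H j := by
  have := h.mul_mem_of_shortest hJ hu hj (mul_mem (Subgroup.subset_closure hj) hx)
    (h.mul_mem_of_notMem (hJ hj) hxj)
  rw [mul_assoc] at this
  exact (h.mul_mem_iff (hJ hj)).1 this

/-- For `u` shortest in its double coset, the intersection of `⟨J⟩` and `u⟨J'⟩u⁻¹` is generated
by the elements of `J` that `u⁻¹` conjugates into `J'`. -/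
theorem mem_closure_of_conj_mem (h : IsFoldingSystem S H) {J J' : Set W} (hJ : J ⊆ S)
    (hJ' : J' ⊆ S) {u : W}
    (hu : ∀ a ∈ Subgroup.closure J, ∀ b ∈ Subgroup.closure J',
      wordLength S u ≤ wordLength S (a * u * b)) {x : W} (hx : x ∈ Subgroup.closure J)
    (hxu : u⁻¹ * x * u ∈ Subgroup.closure J') :
    x ∈ Subgroup.closure {j ∈ J | u⁻¹ * j * u ∈ J'} := by
  have hu₁ : ∀ a ∈ Subgroup.closure J, wordLength S u ≤ wordLength S (a * u) := fun a ha => by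
    simpa using hu a ha 1 (one_mem _)
  have hu₂ : ∀ b ∈ Subgroup.closure J', wordLength S u⁻¹ ≤ wordLength S (b * u⁻¹) := by
    intro b hb
    rw [h.wordLength_inv, ← h.wordLength_inv (b * u⁻¹)]
    simpa using hu 1 (one_mem _) b⁻¹ (inv_mem hb)
  -- if `u⁻¹` conjugates a simple reflection into `⟨J'⟩`, the result is again simple
  have key : ∀ j ∈ J, u⁻¹ * j * u ∈ Subgroup.closure J' → u⁻¹ * j * u ∈ J' := by
    intro j hj hr
    have hr1 : u⁻¹ * j * u ≠ 1 := by
      intro h1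
      apply h.ne_one (hJ hj)
      rw [mul_eq_one_iff_eq_inv, mul_eq_left] at h1
      exact h1
    obtain ⟨i, hi, hri⟩ : ∃ i ∈ J', u⁻¹ * j * u ∉ H i := by
      generalize u⁻¹ * j * u = r at hr hr1
      refine h.closure_induction hJ' (p := fun r => r ≠ 1 → ∃ i ∈ J', r ∉ H i)
        (fun h1 => absurd rfl h1) ?_ hr hr1
      exact fun i hi w _ hw _ _ => ⟨i, hi, h.mul_notMem i (hJ' hi) w hw⟩
    have h1 := h.mul_notMem_of_shortest hJ' hu₂ hi hr hri
    have h2 : u⁻¹ ∈ H i := by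
      simpa using h.mul_mem_of_shortest hJ' hu₂ hi (one_mem _) (h.one_mem_half i (hJ' hi))
    rw [mul_inv_cancel_right] at h1
    rw [← h.fold i (hJ' hi) j (hJ hj) _ h2 h1, inv_mul_cancel_right]
    exact hi
  refine h.closure_induction hJ (p := fun x => u⁻¹ * x * u ∈ Subgroup.closure J' →
    x ∈ Subgroup.closure {j ∈ J | u⁻¹ * j * u ∈ J'}) (fun _ => one_mem _) ?_ hx hxu
  intro j hj w hw hwj ih hjw
  have h1 : u ∈ H j := by
    simpa using h.mul_mem_of_shortest hJ hu₁ hj (one_mem _) (h.one_mem_half j (hJ hj))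
  have h2 : j * (w * u) ∉ H j :=
    h.mul_notMem j (hJ hj) _ (h.mul_mem_of_shortest hJ hu₁ hj hw hwj)
  have h3 : u⁻¹ * j * u ∈ Subgroup.closure J' := by
    by_contra h3
    have h4 := h.mul_mem_of_mem_closure hJ' (hJ hj) h3 h1 hjw
    apply h2
    convert h4 using 1
    group
  refine mul_mem (Subgroup.subset_closure ⟨hj, key j hj h3⟩) (ih ?_)
  have : u⁻¹ * w * u = (u⁻¹ * j * u)⁻¹ * (u⁻¹ * (j * w) * u) := by group
  rw [this]
  exact mul_mem (inv_mem h3) hjw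

theorem exists_shortest (S : Set W) (A B : Subgroup W) (w : W) :
    ∃ a ∈ A, ∃ b ∈ B, ∀ a' ∈ A, ∀ b' ∈ B,
      wordLength S (a * w * b) ≤ wordLength S (a' * (a * w * b) * b') := by
  obtain ⟨p, hp⟩ : ∃ p : A × B, ∀ q : A × B,
      wordLength S (p.1 * w * p.2) ≤ wordLength S (q.1 * w * q.2) :=
    ⟨_, fun q => Function.argmin_le (fun p : A × B => wordLength S (p.1 * w * p.2)) q⟩
  refine ⟨p.1, p.1.2, p.2, p.2.2, fun a' ha' b' hb' => ?_⟩
  have := hp (⟨a', ha'⟩ * p.1, p.2 * ⟨b', hb'⟩)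
  simpa [mul_assoc] using this

end IsFoldingSystem

/-! ### Finite index and conjugation -/

namespace Subgroup

variable {G : Type*} [Group G]

theorem relIndex_ne_zero_of_finite_image {α : Type*} {A L : Subgroup G} (f : G → α)
    (hf : (f '' (A : Set G)).Finite) (h : ∀ x ∈ A, ∀ y ∈ A, f x = f y → x⁻¹ * y ∈ L) :
    L.relIndex A ≠ 0 := by
  have := hf.to_subtype
  have hfin : Finite (A ⧸ L.subgroupOf A) := by
    refine Finite.of_injective
      (fun q => (⟨f (Quotient.out q : A), _, (Quotient.out q : A).2, rfl⟩ : f '' (A : Set G))) ?_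
    intro p q hpq
    rw [← Quotient.out_eq p, ← Quotient.out_eq q]
    refine QuotientGroup.eq.2 (mem_subgroupOf.2 ?_)
    exact h _ (Quotient.out p).2 _ (Quotient.out q).2 (congrArg Subtype.val hpq)
  exact (finiteIndex_of_finite_quotient (H := L.subgroupOf A)).index_ne_zero

theorem mem_toConjAct_smul_iff {A : Subgroup G} {g x : G} :
    x ∈ ConjAct.toConjAct g • A ↔ g⁻¹ * x * g ∈ A := by
  rw [mem_pointwise_smul_iff_inv_smul_mem, ← ConjAct.toConjAct_inv, ConjAct.toConjAct_smul,
    inv_inv]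

theorem toConjAct_smul_eq_self {A : Subgroup G} {g : G} (hg : g ∈ A) :
    ConjAct.toConjAct g • A = A := by
  ext x
  rw [mem_toConjAct_smul_iff, A.mul_mem_cancel_right hg, A.mul_mem_cancel_left (inv_mem hg)]

/-- The index of `A ⊓ gLg⁻¹` in `A` is finite if and only if `AgL` is a finite union of left cosets
of `L`. -/
theorem relIndex_conj_ne_zero_iff {A L : Subgroup G} {g : G} :
    (ConjAct.toConjAct g • L).relIndex A ≠ 0 ↔
      ((fun a => (QuotientGroup.mk (a * g) : G ⧸ L)) '' (A : Set G)).Finite := by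
  have hiff : ∀ x y : G, (QuotientGroup.mk (x * g) : G ⧸ L) = QuotientGroup.mk (y * g) ↔
      x⁻¹ * y ∈ ConjAct.toConjAct g • L := by
    intro x y
    rw [QuotientGroup.eq, mem_toConjAct_smul_iff]
    simp only [mul_inv_rev, mul_assoc]
  constructor
  · intro h
    have : Finite (A ⧸ (ConjAct.toConjAct g • L).subgroupOf A) := by
      have : ((ConjAct.toConjAct g • L).subgroupOf A).FiniteIndex := ⟨h⟩
      exact finite_quotient_of_finiteIndex
    refine (Set.finite_range fun q : A ⧸ (ConjAct.toConjAct g • L).subgroupOf A =>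
      (QuotientGroup.mk ((Quotient.out q : A) * g) : G ⧸ L)).subset ?_
    rintro _ ⟨a, ha, rfl⟩
    refine ⟨QuotientGroup.mk ⟨a, ha⟩, (hiff _ _).2 ?_⟩
    have := QuotientGroup.eq.1 (Quotient.out_eq
      (QuotientGroup.mk ⟨a, ha⟩ : A ⧸ (ConjAct.toConjAct g • L).subgroupOf A))
    exact mem_subgroupOf.1 this
  · intro h
    exact relIndex_ne_zero_of_finite_image _ h fun x _ y _ hxy => (hiff x y).1 hxy

theorem relIndex_ne_zero_mono_right {A A' L : Subgroup G} (h : L.relIndex A ≠ 0) (hA : A' ≤ A) :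
    L.relIndex A' ≠ 0 :=
  fun h0 => h (relIndex_eq_zero_of_le_right hA h0)

theorem relIndex_conj (c : G) (A L : Subgroup G) :
    (ConjAct.toConjAct c • L).relIndex (ConjAct.toConjAct c • A) = L.relIndex A :=
  relIndex_pointwise_smul _ _ _

theorem relIndex_conj_inv (c : G) (A L : Subgroup G) :
    L.relIndex (ConjAct.toConjAct c⁻¹ • A) = (ConjAct.toConjAct c • L).relIndex A := by
  rw [← relIndex_conj c, smul_smul, ← ConjAct.toConjAct_mul, mul_inv_cancel,
    ConjAct.toConjAct_one, one_smul]

theorem le_commensurator (A : Subgroup G) : A ≤ Commensurable.commensurator A := by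
  intro g hg
  rw [Commensurable.commensurator_mem_iff, toConjAct_smul_eq_self hg]

end Subgroup

/-! ### Parabolic subgroups without proper parabolic subgroups of finite index -/

/-- `K` is rigid if no proper subset of `K` generates a subgroup of finite index in `⟨K⟩`. -/
def IsRigid {W : Type*} [Group W] (K : Set W) : Prop :=
  ∀ L ⊆ K, (Subgroup.closure L).relIndex (Subgroup.closure K) ≠ 0 → L = K

theorem exists_isRigid {W : Type*} [Group W] {J : Set W} (hJ : J.Finite) :
    ∃ K ⊆ J, IsRigid K ∧ (Subgroup.closure K).relIndex (Subgroup.closure J) ≠ 0 := by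
  have hfin : {K | K ⊆ J ∧ (Subgroup.closure K).relIndex (Subgroup.closure J) ≠ 0}.Finite :=
    hJ.finite_subsets.subset fun K hK => hK.1
  obtain ⟨K, hK⟩ := hfin.exists_minimal ⟨J, subset_rfl, by simp⟩
  refine ⟨K, hK.prop.1, fun L hL hLK => ?_, hK.prop.2⟩
  exact hL.antisymm
    (hK.le_of_le ⟨hL.trans hK.prop.1, Subgroup.relIndex_ne_zero_trans hLK hK.prop.2⟩ hL)

namespace IsFoldingSystem

variable {W : Type*} [Group W] {S : Set W} {H : W → Set W}

/-- Suppose that `u⁻¹` conjugates `K` into `S`, that `s ∉ ⟨K⟩` and that the wall of `s` separates `1`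
from `u`. Then so do all walls `xsx⁻¹` with `x ∈ ⟨K⟩`: the galleries of type `K` from `1` to `x⁻¹`
and from `u` to `x⁻¹u` do not cross the wall of `s`. Only finitely many walls separate `1`
from `u`. -/
theorem finite_conj_of_conj_subset (h : IsFoldingSystem S H) {K : Set W} (hK : K ⊆ S) {s u : W}
    (hs : s ∈ S) (hsK : s ∉ Subgroup.closure K) (hsu : u ∉ H s)
    (huK : ∀ k ∈ K, u⁻¹ * k * u ∈ S) :
    ((fun x => x * s * x⁻¹) '' (Subgroup.closure K : Set W)).Finite := by
  obtain ⟨l, hl, rfl⟩ := h.exists_word subset_rfl (w := u) (by simp [h.closure_eq_top])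
  set u := l.prod with hu
  have hconj : ∀ y, y ∈ Subgroup.closure ((fun k => u⁻¹ * k * u) '' K) ↔
      u * y * u⁻¹ ∈ Subgroup.closure K := by
    intro y
    have h1 : (fun k => u⁻¹ * k * u) '' K = (MulAut.conj u⁻¹).toMonoidHom '' K := by
      refine Set.image_congr fun k _ => ?_
      simp only [MulEquiv.coe_toMonoidHom, MulAut.conj_apply, inv_inv]
    rw [h1, ← MonoidHom.map_closure, Subgroup.mem_map_equiv]
    simp
  refine (Set.finite_range fun i : Fin (l.length + 1) =>
    (l.take (i + 1)).prod * (l.take i).prod⁻¹).subset ?_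
  rintro _ ⟨x, hx, rfl⟩
  have hx' : x⁻¹ ∈ Subgroup.closure K := inv_mem hx
  have h1 : x⁻¹ ∈ H s := by
    simpa using h.mul_mem_of_mem_closure hK hs (u := 1) (by simpa using hsK) (h.one_mem_half s hs)
      hx'
  have h2 : x⁻¹ * u ∉ H s := by
    intro h2
    apply hsu
    have h3 := h.mul_mem_of_mem_closure (J := (fun k => u⁻¹ * k * u) '' K)
      (by rintro _ ⟨k, hk, rfl⟩; exact huK k hk) hs (u := x⁻¹ * u) (y := u⁻¹ * x * u) ?_ h2 ?_
    · convert h3 using 1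
      group
    · rw [hconj]
      intro h4
      apply hsK
      convert mul_mem (mul_mem hx' h4) hx using 1
      group
    · rw [hconj]
      have : u * (u⁻¹ * x * u) * u⁻¹ = x := by group
      rw [this]
      exact hx
  obtain ⟨l₁, t, l₂, e, e'⟩ := h.exists_crossing hs l hl x⁻¹ h1 h2
  have ht : t ∈ S := hl t (by simp [e])
  refine ⟨⟨l₁.length, by simp [e]⟩, ?_⟩
  have h3 : l.take l₁.length = l₁ := by simp [e]
  have h4 : l.take (l₁.length + 1) = l₁ ++ [t] := by simp [e, List.take_append]
  simp only [h3, h4, List.prod_append, List.prod_singleton]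
  rw [mul_inv_eq_iff_eq_mul]
  calc l₁.prod * t = x * (x⁻¹ * l₁.prod * t) := by group
    _ = x * s * x⁻¹ * l₁.prod := by rw [← e']; group

/-- If `u⁻¹` conjugates a rigid `K` into `S`, and left multiplication by any element of `K` lengthens
`u`, then `u` is a product of elements of `S` that commute with `K`. -/
theorem mem_closure_commuting (h : IsFoldingSystem S H) {K : Set W} (hK : K ⊆ S) (hrig : IsRigid K)
    {u : W} (hu : ∀ k ∈ K, u ∈ H k) (huK : ∀ k ∈ K, u⁻¹ * k * u ∈ S) :
    u ∈ Subgroup.closure {s ∈ S | ∀ k ∈ K, Commute s k} := by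
  induction hn : wordLength S u using Nat.strong_induction_on generalizing u with
  | _ n ih =>
    subst hn
    obtain ⟨l, hl, rfl, hlen⟩ := h.exists_reduced_word u
    cases l with
    | nil => exact one_mem _
    | cons s l =>
      set v := l.prod with hv
      rw [List.prod_cons, ← hv] at hu huK hlen ih ⊢
      have hs : s ∈ S := hl s (by simp)
      have hvs : wordLength S v < wordLength S (s * v) := by
        have : wordLength S v ≤ l.length := wordLength_prod_le fun t ht => hl t (by simp [ht])
        simp only [List.length_cons] at hlen
        omega
      have hsu : s * v ∉ H s := by
        intro h1
        have := h.lt_wordLength_mul hs h1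
        rw [h.mul_mul_cancel hs] at this
        omega
      have hsK : s ∉ Subgroup.closure K := fun h1 =>
        hsu (hu s (h.mem_of_mem_closure hK hs h1))
      have hmin : ∀ a ∈ Subgroup.closure K, ∀ b ∈ Subgroup.closure K,
          wordLength S s ≤ wordLength S (a * s * b) := by
        intro a ha b hb
        have h1 : wordLength S s ≤ 1 := by
          simpa using wordLength_prod_le (S := S) (l := [s]) (by simpa using hs)
        refine h1.trans (Nat.one_le_iff_ne_zero.2 fun h0 => hsK ?_)
        obtain ⟨m, _, hm, hm0⟩ := h.exists_reduced_word (a * s * b)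
        rw [h0, List.length_eq_zero_iff] at hm0
        subst hm0
        rw [List.prod_nil] at hm
        have : s = a⁻¹ * b⁻¹ := by
          rw [eq_inv_mul_iff_mul_eq, eq_inv_iff_mul_eq_one, hm]
        rw [this]
        exact mul_mem (inv_mem ha) (inv_mem hb)
      have hfix : {k ∈ K | s⁻¹ * k * s ∈ K} = K := by
        refine hrig _ (Set.sep_subset _ _) (Subgroup.relIndex_ne_zero_of_finite_image _
          (h.finite_conj_of_conj_subset hK hs hsK hsu huK) ?_)
        intro x hx y hy hxy
        have hxy' : s⁻¹ * (x⁻¹ * y) * s = x⁻¹ * y := by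
          have h1 : x * s * x⁻¹ = y * s * y⁻¹ := hxy
          rw [mul_assoc, inv_mul_eq_iff_eq_mul]
          calc x⁻¹ * y * s = x⁻¹ * (y * s * y⁻¹) * y := by group
            _ = s * (x⁻¹ * y) := by rw [← h1]; group
        refine h.mem_closure_of_conj_mem hK hK hmin (mul_mem (inv_mem hx) hy) ?_
        rw [hxy']
        exact mul_mem (inv_mem hx) hy
      have hcomm : ∀ k ∈ K, s * k = k * s := by
        intro k hk
        have h1 : s⁻¹ * k * s ∈ K := (hfix.symm ▸ hk : k ∈ {k ∈ K | s⁻¹ * k * s ∈ K}).2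
        have hsk : ({s, k} : Set W) ⊆ S := by
          rintro _ (rfl | rfl)
          exacts [hs, hK hk]
        have h2 : s⁻¹ * k * s ∈ ({s, k} : Set W) := by
          refine h.mem_of_mem_closure hsk (hK h1) ?_
          have h3 : s ∈ Subgroup.closure ({s, k} : Set W) := Subgroup.subset_closure (by simp)
          have h4 : k ∈ Subgroup.closure ({s, k} : Set W) := Subgroup.subset_closure (by simp)
          exact mul_mem (mul_mem (inv_mem h3) h4) h3
        rcases h2 with h2 | h2
        · exact absurd (Subgroup.subset_closure (h2 ▸ h1)) hsK
        · rw [Set.mem_singleton_iff, mul_assoc, inv_mul_eq_iff_eq_mul] at h2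
          exact h2.symm
      refine mul_mem (Subgroup.subset_closure ⟨hs, hcomm⟩) (ih _ hvs ?_ ?_ rfl)
      · intro k hk
        by_contra hvk
        have h1 := h.wordLength_mul_lt (hK hk) hvk
        have h2 := h.lt_wordLength_mul (hK hk) (hu k hk)
        have h3 := h.wordLength_mul_le hs (k * v)
        rw [← mul_assoc, hcomm k hk, mul_assoc] at h3
        omega
      · intro k hk
        have : v⁻¹ * k * v = (s * v)⁻¹ * k * (s * v) := by
          calc v⁻¹ * k * v = v⁻¹ * s⁻¹ * (s * k) * v := by group
            _ = (s * v)⁻¹ * k * (s * v) := by rw [hcomm k hk]; group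
        rw [this]
        exact huK k hk

/-- If a conjugate of `⟨K⟩` with `K` rigid is virtually contained in `⟨J⟩`, then `K ⊆ J`, and the
conjugating element centralizes `⟨K⟩` up to factors in `⟨J⟩` and `⟨K⟩`. -/
theorem subset_of_relIndex_conj_ne_zero (h : IsFoldingSystem S H) {K J : Set W} (hK : K ⊆ S)
    (hJ : J ⊆ S) (hrig : IsRigid K) {w : W}
    (hw : (Subgroup.closure J).relIndex (ConjAct.toConjAct w • Subgroup.closure K) ≠ 0) :
    K ⊆ J ∧ ∃ b ∈ Subgroup.closure J,
      ∃ c ∈ Subgroup.closure {s ∈ S | ∀ k ∈ K, Commute s k},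
        ∃ a ∈ Subgroup.closure K, w = b * c * a := by
  obtain ⟨a, ha, b, hb, hmin⟩ :=
    exists_shortest S (Subgroup.closure K) (Subgroup.closure J) w⁻¹
  set u := a * w⁻¹ * b with hu
  have hidx : (ConjAct.toConjAct u • Subgroup.closure J).relIndex (Subgroup.closure K) ≠ 0 := by
    have h1 := Subgroup.relIndex_conj a (Subgroup.closure K)
      (ConjAct.toConjAct w⁻¹ • Subgroup.closure J)
    rw [Subgroup.toConjAct_smul_eq_self ha] at h1
    rw [hu, ConjAct.toConjAct_mul, ConjAct.toConjAct_mul, mul_smul, mul_smul,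
      Subgroup.toConjAct_smul_eq_self hb, h1, ← Subgroup.relIndex_conj_inv, inv_inv]
    exact hw
  have hL : {k ∈ K | u⁻¹ * k * u ∈ J} = K := by
    refine hrig _ (Set.sep_subset _ _) fun h0 => hidx ?_
    rw [← Subgroup.inf_relIndex_right]
    refine Subgroup.relIndex_eq_zero_of_le_left ?_ h0
    rintro x ⟨hx1, hx2⟩
    exact h.mem_closure_of_conj_mem hK hJ hmin hx2 (Subgroup.mem_toConjAct_smul_iff.1 hx1)
  have huJ : ∀ k ∈ K, u⁻¹ * k * u ∈ J := fun k hk =>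
    (hL.symm ▸ hk : k ∈ {k ∈ K | u⁻¹ * k * u ∈ J}).2
  have huc : u ∈ Subgroup.closure {s ∈ S | ∀ k ∈ K, Commute s k} := by
    refine h.mem_closure_commuting hK hrig (fun k hk => ?_) fun k hk => hJ (huJ k hk)
    simpa using h.mul_mem_of_shortest hK (fun a ha => by simpa using hmin a ha 1 (one_mem _)) hk
      (one_mem _) (h.one_mem_half k (hK hk))
  refine ⟨fun k hk => ?_, b, hb, u⁻¹, inv_mem huc, a, ha, by rw [hu]; group⟩
  have hcent : Commute u k := by
    have hle : Subgroup.closure {s ∈ S | ∀ k ∈ K, Commute s k} ≤ Subgroup.centralizer {k} :=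
      (Subgroup.closure_le _).2 fun s hs =>
        Subgroup.mem_centralizer_singleton_iff.2 (hs.2 k hk)
    exact Subgroup.mem_centralizer_singleton_iff.1 (hle huc)
  have h1 := huJ k hk
  rwa [mul_assoc, ← hcent.eq, inv_mul_cancel_left] at h1

end IsFoldingSystem

/-! ### The folding system of a BN-pair -/

namespace BNPair

variable {G : Type*} [Group G] (P : BNPair G)

theorem mem_bruhatCell {w : P.Weyl} {g : G} :
    g ∈ bruhatCell P.B P.N w ↔
      ∃ b ∈ P.B, ∃ n : P.N, (QuotientGroup.mk n : P.Weyl) = w ∧ ∃ b' ∈ P.B, b * n * b' = g :=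
  P.mem_bruhatCells

theorem mem_bruhatCell_mk (n : P.N) : (n : G) ∈ bruhatCell P.B P.N (QuotientGroup.mk n) :=
  P.mem_bruhatCell.2 ⟨1, one_mem _, n, rfl, 1, one_mem _, by simp⟩

theorem mul_mem_bruhatCell {b g : G} {w : P.Weyl} (hb : b ∈ P.B)
    (hg : g ∈ bruhatCell P.B P.N w) : b * g ∈ bruhatCell P.B P.N w := by
  obtain ⟨c, hc, n, hn, c', hc', rfl⟩ := P.mem_bruhatCell.1 hg
  exact P.mem_bruhatCell.2 ⟨b * c, mul_mem hb hc, n, hn, c', hc', by group⟩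

theorem bruhatCell_mul_mem {b g : G} {w : P.Weyl} (hg : g ∈ bruhatCell P.B P.N w)
    (hb : b ∈ P.B) : g * b ∈ bruhatCell P.B P.N w := by
  obtain ⟨c, hc, n, hn, c', hc', rfl⟩ := P.mem_bruhatCell.1 hg
  exact P.mem_bruhatCell.2 ⟨c, hc, n, hn, c' * b, mul_mem hc' hb, by group⟩

theorem inv_mem_bruhatCell {g : G} {w : P.Weyl} (hg : g ∈ bruhatCell P.B P.N w) :
    g⁻¹ ∈ bruhatCell P.B P.N w⁻¹ := by
  obtain ⟨c, hc, n, rfl, c', hc', rfl⟩ := P.mem_bruhatCell.1 hg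
  exact P.mem_bruhatCell.2 ⟨c'⁻¹, inv_mem hc', n⁻¹, rfl, c⁻¹, inv_mem hc, by push_cast; group⟩

theorem mk_eq_one_iff {n : P.N} : (QuotientGroup.mk n : P.Weyl) = 1 ↔ (n : G) ∈ P.B := by
  rw [QuotientGroup.eq_one_iff, Subgroup.mem_subgroupOf]

theorem mem_bruhatCell_one {g : G} : g ∈ bruhatCell P.B P.N (1 : P.Weyl) ↔ g ∈ P.B := by
  constructor
  · intro hg
    obtain ⟨c, hc, n, hn, c', hc', rfl⟩ := P.mem_bruhatCell.1 hg
    exact mul_mem (mul_mem hc (P.mk_eq_one_iff.1 hn)) hc'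
  · intro hg
    exact P.mem_bruhatCell.2 ⟨g, hg, 1, rfl, 1, one_mem _, by simp⟩

theorem inv_eq_of_mem {s : P.Weyl} (hs : s ∈ P.S) : s⁻¹ = s :=
  inv_eq_of_mul_eq_one_left (P.mul_self_of_mem s hs)

theorem ne_one_of_mem {s : P.Weyl} (hs : s ∈ P.S) : s ≠ 1 := by
  rintro rfl
  refine P.not_conj_le 1 hs ?_
  simp

theorem mul_mem_cell_or {s w : P.Weyl} (hs : s ∈ P.S) {x y : G}
    (hx : x ∈ bruhatCell P.B P.N w) (hy : y ∈ bruhatCell P.B P.N s) :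
    x * y ∈ bruhatCell P.B P.N w ∨ x * y ∈ bruhatCell P.B P.N (w * s) :=
  P.cell_mul_subset s hs w (Set.mul_mem_mul hx hy)

/-- The mirror image of the axiom `BwB · BsB ⊆ BwB ∪ BwsB`, by inversion. -/
theorem mul_mem_cell_or' {s w : P.Weyl} (hs : s ∈ P.S) {x y : G}
    (hx : x ∈ bruhatCell P.B P.N s) (hy : y ∈ bruhatCell P.B P.N w) :
    x * y ∈ bruhatCell P.B P.N w ∨ x * y ∈ bruhatCell P.B P.N (s * w) := by
  have hx' := P.inv_mem_bruhatCell hx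
  rw [P.inv_eq_of_mem hs] at hx'
  rcases P.mul_mem_cell_or hs (P.inv_mem_bruhatCell hy) hx' with h | h
  · left
    simpa using P.inv_mem_bruhatCell h
  · right
    simpa [P.inv_eq_of_mem hs] using P.inv_mem_bruhatCell h

/-- Distinct Bruhat cells are disjoint; by induction on the length of the shorter element. -/
theorem bruhatCell_unique {w w' : P.Weyl} {g : G} (hg : g ∈ bruhatCell P.B P.N w)
    (hg' : g ∈ bruhatCell P.B P.N w') : w = w' := by
  have key : ∀ (l : List P.Weyl), (∀ t ∈ l, t ∈ P.S) → ∀ (w : P.Weyl) (g : G),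
      l.length ≤ wordLength P.S w → g ∈ bruhatCell P.B P.N w →
      g ∈ bruhatCell P.B P.N l.prod → w = l.prod := by
    intro l
    induction l with
    | nil =>
      intro _ w g _ hg hg'
      obtain ⟨c, hc, n, rfl, c', hc', rfl⟩ := P.mem_bruhatCell.1 hg
      have h1 := P.mem_bruhatCell_one.1 hg'
      rw [P.B.mul_mem_cancel_right hc', P.B.mul_mem_cancel_left hc] at h1
      exact P.mk_eq_one_iff.2 h1
    | cons s l ih =>
      intro hl w g hw hg hg'
      have hs : s ∈ P.S := hl s (by simp)
      have hl' : ∀ t ∈ l, t ∈ P.S := fun t ht => hl t (by simp [ht])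
      obtain ⟨m, rfl⟩ := QuotientGroup.mk_surjective s
      obtain ⟨c, hc, n, hn, c', hc', rfl⟩ := P.mem_bruhatCell.1 hg'
      set x : G := (m : G)⁻¹ * (c⁻¹ * (c * n * c')) with hx
      have h1 : x ∈ bruhatCell P.B P.N l.prod := by
        refine P.mem_bruhatCell.2 ⟨1, one_mem _, m⁻¹ * n, ?_, c', hc', ?_⟩
        · rw [QuotientGroup.mk_mul, hn, List.prod_cons, QuotientGroup.mk_inv,
            inv_mul_cancel_left]
        · push_cast
          rw [hx]
          group
      have hm : (m : G)⁻¹ ∈ bruhatCell P.B P.N (QuotientGroup.mk m) := by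
        simpa [P.inv_eq_of_mem hs] using P.inv_mem_bruhatCell (P.mem_bruhatCell_mk m)
      simp only [List.length_cons] at hw
      rcases P.mul_mem_cell_or' hs hm (P.mul_mem_bruhatCell (inv_mem hc) hg) with h2 | h2
      · have h3 := ih hl' w x (by omega) h2 h1
        have h4 := wordLength_prod_le hl'
        rw [← h3] at h4
        omega
      · have h5 := wordLength_mul_le_add_one P.mul_self_of_mem P.closure_S hs
          (QuotientGroup.mk m * w)
        rw [← mul_assoc, P.mul_self_of_mem _ hs, one_mul] at h5
        have h3 := ih hl' _ x (by omega) h2 h1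
        rw [List.prod_cons, ← h3, ← mul_assoc, P.mul_self_of_mem _ hs, one_mul]
  obtain ⟨l, hl, rfl, e⟩ := exists_word_length_eq P.mul_self_of_mem P.closure_S w
  obtain ⟨l', hl', rfl, e'⟩ := exists_word_length_eq P.mul_self_of_mem P.closure_S w'
  rcases le_total l.length l'.length with h | h
  · exact (key l hl _ g (e' ▸ h) hg' hg).symm
  · exact key l' hl' _ g (e ▸ h) hg hg'

/-- The elements `w` of the Weyl group with `sBw ⊆ BswB`. In a Coxeter system they are the `w` for
which `s * w` is longer than `w`. -/
def halfSpace (s : P.Weyl) : Set P.Weyl :=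
  {w | ∀ m n : P.N, (QuotientGroup.mk m : P.Weyl) = s → (QuotientGroup.mk n : P.Weyl) = w →
    ∀ b ∈ P.B, (m : G) * b * n ∈ bruhatCell P.B P.N (s * w)}

theorem isFoldingSystem : IsFoldingSystem P.S P.halfSpace where
  mul_self := P.mul_self_of_mem
  closure_eq_top := P.closure_S
  one_mem_half := by
    rintro s - m n rfl hn b hb
    rw [mul_one, mul_assoc]
    exact P.bruhatCell_mul_mem (P.mem_bruhatCell_mk m) (mul_mem hb (P.mk_eq_one_iff.1 hn))
  mul_notMem := by
    intro s hs w hw hsw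
    obtain ⟨m, rfl⟩ := QuotientGroup.mk_surjective s
    obtain ⟨n, rfl⟩ := QuotientGroup.mk_surjective w
    obtain ⟨b, hb, hbB⟩ : ∃ b ∈ P.B, (m : G) * b * (m : G)⁻¹ ∉ P.B := by
      by_contra! hc
      refine P.not_conj_le m hs fun x hx => ?_
      have := hc _ (Subgroup.mem_toConjAct_smul_iff.1 hx)
      simpa [mul_assoc] using this
    -- `m * b * m⁻¹` lies in `BsB`, so `m * b * m⁻¹ * n` lies both in `BswB` and in `BwB`
    have hm : (m : G)⁻¹ ∈ bruhatCell P.B P.N (QuotientGroup.mk m) := by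
      simpa [P.inv_eq_of_mem hs] using P.inv_mem_bruhatCell (P.mem_bruhatCell_mk m)
    rcases P.mul_mem_cell_or hs (P.bruhatCell_mul_mem (P.mem_bruhatCell_mk m) hb) hm with h | h
    · obtain ⟨c, hc, k, hk, c', hc', e⟩ := P.mem_bruhatCell.1 h
      have h1 := P.mul_mem_bruhatCell hc (hw k n hk rfl c' hc')
      have h2 := hsw m (m⁻¹ * n) rfl
        (by rw [QuotientGroup.mk_mul, QuotientGroup.mk_inv, P.inv_eq_of_mem hs]) b hb
      have h3 : c * ((k : G) * c' * n) = (m : G) * b * (m⁻¹ * n : P.N) := by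
        push_cast
        calc c * ((k : G) * c' * n) = c * k * c' * n := by group
          _ = _ := by rw [e]; group
      rw [h3] at h1
      have h4 := P.bruhatCell_unique h1 h2
      rw [mul_right_inj, right_eq_mul] at h4
      exact P.ne_one_of_mem hs h4
    · rw [P.mul_self_of_mem _ hs] at h
      exact hbB (P.mem_bruhatCell_one.1 h)
  fold := by
    intro s hs t ht w hw hwt
    simp only [halfSpace, Set.mem_ofPred_eq, not_forall] at hwt
    obtain ⟨m, n, rfl, hn, b, hb, hcell⟩ := hwt
    obtain ⟨k, rfl⟩ := QuotientGroup.mk_surjective t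
    have h1 : (m : G) * b * n ∈ bruhatCell P.B P.N (w * QuotientGroup.mk k) := by
      rw [← hn] at hcell ⊢
      exact (P.mul_mem_cell_or' hs (P.bruhatCell_mul_mem (P.mem_bruhatCell_mk m) hb)
        (P.mem_bruhatCell_mk n)).resolve_right hcell
    have hk : (k : G)⁻¹ ∈ bruhatCell P.B P.N (QuotientGroup.mk k) := by
      simpa [P.inv_eq_of_mem ht] using P.inv_mem_bruhatCell (P.mem_bruhatCell_mk k)
    have h2 := hw m (n * k⁻¹) rfl (by rw [QuotientGroup.mk_mul, hn]; simp) b hb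
    have h3 : (m : G) * b * (n * k⁻¹ : P.N) = (m : G) * b * n * (k : G)⁻¹ := by
      push_cast
      group
    rw [h3] at h2
    rcases P.mul_mem_cell_or ht h1 hk with h4 | h4
    · exact P.bruhatCell_unique h2 h4
    · rw [mul_assoc w, P.mul_self_of_mem _ ht, mul_one] at h4
      have h5 := P.bruhatCell_unique h2 h4
      rw [mul_eq_right] at h5
      exact absurd h5 (P.ne_one_of_mem hs)

/-! ### Parabolic subgroups of a group with a BN-pair -/

theorem mem_parabolic {J : Set P.S} {g : G} :
    g ∈ P.parabolic J ↔ ∃ b ∈ P.B, ∃ n : P.N,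
      (QuotientGroup.mk n : P.Weyl) ∈ Subgroup.closure (Subtype.val '' J) ∧
        ∃ b' ∈ P.B, b * n * b' = g :=
  P.mem_bruhatCells

theorem B_le_parabolic (J : Set P.S) : P.B ≤ P.parabolic J := fun b hb =>
  P.mem_parabolic.2 ⟨b, hb, 1, one_mem _, 1, one_mem _, by simp⟩

theorem coe_mem_parabolic_iff {J : Set P.S} {n : P.N} :
    (n : G) ∈ P.parabolic J ↔
      (QuotientGroup.mk n : P.Weyl) ∈ Subgroup.closure (Subtype.val '' J) := by
  constructor
  · intro h
    obtain ⟨b, hb, k, hk, b', hb', e⟩ := P.mem_parabolic.1 h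
    rwa [P.bruhatCell_unique (P.mem_bruhatCell_mk n)
      (P.mem_bruhatCell.2 ⟨b, hb, k, rfl, b', hb', e⟩)]
  · intro h
    exact P.mem_parabolic.2 ⟨1, one_mem _, n, h, 1, one_mem _, by simp⟩

/-- The Bruhat decomposition `G = BNB`. -/
theorem exists_eq_mul_mul (g : G) : ∃ b ∈ P.B, ∃ n : P.N, ∃ b' ∈ P.B, g = b * n * b' := by
  have h : P.B ⊔ P.N ≤ P.parabolic Set.univ := by
    refine sup_le (P.B_le_parabolic _) fun n hn => ?_
    refine P.coe_mem_parabolic_iff (n := ⟨n, hn⟩).2 ?_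
    simp [P.closure_S]
  rw [P.sup_eq_top] at h
  obtain ⟨b, hb, n, -, b', hb', e⟩ := P.mem_parabolic.1 (h (Subgroup.mem_top g))
  exact ⟨b, hb, n, b', hb', e.symm⟩

/-- Virtual containment passes from parabolic subgroups of `G` to those of the Weyl group, since
`N ∩ P_J'` is the preimage of `W_J'`. -/
theorem relIndex_weyl_ne_zero {J J' : Set P.S} {n : P.N}
    (h : (P.parabolic J').relIndex (ConjAct.toConjAct (n : G) • P.parabolic J) ≠ 0) :
    (Subgroup.closure (Subtype.val '' J')).relIndex
      (ConjAct.toConjAct (QuotientGroup.mk n : P.Weyl) •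
        Subgroup.closure (Subtype.val '' J)) ≠ 0 := by
  rw [← inv_inv (n : G), Subgroup.relIndex_conj_inv, Subgroup.relIndex_conj_ne_zero_iff] at h
  rw [← inv_inv (QuotientGroup.mk n : P.Weyl), Subgroup.relIndex_conj_inv]
  refine Subgroup.relIndex_ne_zero_of_finite_image
    (fun v : P.Weyl => (QuotientGroup.mk ((Quotient.out v : P.N) * (n : G)⁻¹) :
      G ⧸ P.parabolic J')) (h.subset ?_) ?_
  · rintro _ ⟨v, hv, rfl⟩
    exact ⟨_, P.coe_mem_parabolic_iff.2 (by rwa [QuotientGroup.out_eq']), rfl⟩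
  · intro v _ v' _ hvv'
    have h1 := QuotientGroup.eq.1 hvv'
    have h2 : ((Quotient.out v : P.N) * (n : G)⁻¹)⁻¹ * ((Quotient.out v' : P.N) * (n : G)⁻¹) =
        (n * (Quotient.out v)⁻¹ * Quotient.out v' * n⁻¹ : P.N) := by
      push_cast
      group
    rw [h2, P.coe_mem_parabolic_iff] at h1
    rw [Subgroup.mem_toConjAct_smul_iff]
    simpa [mul_assoc] using h1

/-- If `B` is commensurated, then `BgP_J` is a finite union of left cosets of `P_J`. -/
theorem finite_cosets (hB : IsCommensurated P.B) (J : Set P.S) (g : G) :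
    ((fun b => (QuotientGroup.mk (b * g) : G ⧸ P.parabolic J)) '' (P.B : Set G)).Finite := by
  rw [← Subgroup.relIndex_conj_ne_zero_iff]
  refine fun h0 => (hB g).1 (Subgroup.relIndex_eq_zero_of_le_left ?_ h0)
  intro x hx
  rw [Subgroup.mem_toConjAct_smul_iff] at hx ⊢
  exact P.B_le_parabolic J hx

/-- Virtual containment passes from `W_J`, `W_J'` to `P_J`, `P_J'`: if `W_J` is contained in a
finite union of cosets `wW_J'`, then `P_J` is contained in the union of the `BwP_J'`. -/
theorem relIndex_parabolic_ne_zero (hB : IsCommensurated P.B) {J J' : Set P.S}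
    (h : (Subgroup.closure (Subtype.val '' J')).relIndex
      (Subgroup.closure (Subtype.val '' J : Set P.Weyl)) ≠ 0) :
    (P.parabolic J').relIndex (P.parabolic J) ≠ 0 := by
  rw [← one_smul (ConjAct P.Weyl) (Subgroup.closure (Subtype.val '' J')),
    ← ConjAct.toConjAct_one, Subgroup.relIndex_conj_ne_zero_iff] at h
  rw [← one_smul (ConjAct G) (P.parabolic J'), ← ConjAct.toConjAct_one,
    Subgroup.relIndex_conj_ne_zero_iff]
  refine (h.biUnion fun q _ =>
    P.finite_cosets hB J' ((Quotient.out (Quotient.out q : P.Weyl) : P.N) : G)).subset ?_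
  rintro _ ⟨x, hx, rfl⟩
  obtain ⟨b, hb, n, hn, b', hb', rfl⟩ := P.mem_parabolic.1 hx
  rw [Set.mem_iUnion₂]
  refine ⟨QuotientGroup.mk (QuotientGroup.mk n * 1), ⟨_, hn, rfl⟩, b, hb, ?_⟩
  refine QuotientGroup.eq.2 ?_
  generalize hv : Quotient.out (QuotientGroup.mk (QuotientGroup.mk n * 1) :
    P.Weyl ⧸ Subgroup.closure (Subtype.val '' J')) = v
  have h1 : v⁻¹ * QuotientGroup.mk n ∈ Subgroup.closure (Subtype.val '' J') := by
    rw [← QuotientGroup.eq, ← hv, QuotientGroup.out_eq', mul_one]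
  have h2 : (((Quotient.out v)⁻¹ * n : P.N) : G) ∈ P.parabolic J' := by
    rw [P.coe_mem_parabolic_iff, QuotientGroup.mk_mul, QuotientGroup.mk_inv,
      QuotientGroup.out_eq']
    exact h1
  have h3 := mul_mem h2 (P.B_le_parabolic J' hb')
  push_cast at h3
  convert h3 using 1
  group

/-- If `s ∈ S` commutes with `K`, then `P_K s ⊆ P_K ∪ BsP_K`, which is a finite union of left
cosets of `P_K`. -/
theorem relIndex_conj_parabolic_ne_zero (hB : IsCommensurated P.B) {K : Set P.S} {m : P.N}
    (hs : (QuotientGroup.mk m : P.Weyl) ∈ P.S)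
    (hm : ∀ k ∈ (Subtype.val '' K : Set P.Weyl), Commute (QuotientGroup.mk m : P.Weyl) k) :
    (ConjAct.toConjAct (m : G) • P.parabolic K).relIndex (P.parabolic K) ≠ 0 := by
  rw [Subgroup.relIndex_conj_ne_zero_iff]
  refine ((P.finite_cosets hB K m).union (Set.finite_singleton (QuotientGroup.mk 1))).subset ?_
  rintro _ ⟨x, hx, rfl⟩
  obtain ⟨b, hb, n, hn, b', hb', rfl⟩ := P.mem_parabolic.1 hx
  have hcomm : Commute (QuotientGroup.mk m : P.Weyl) (QuotientGroup.mk n) := by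
    have hle : Subgroup.closure (Subtype.val '' K) ≤
        Subgroup.centralizer {(QuotientGroup.mk m : P.Weyl)} :=
      (Subgroup.closure_le _).2 fun k hk =>
        Subgroup.mem_centralizer_singleton_iff.2 (hm k hk).symm.eq
    exact (Subgroup.mem_centralizer_singleton_iff.1 (hle hn)).symm
  rcases P.mul_mem_cell_or hs (P.mem_bruhatCell.2 ⟨b, hb, n, rfl, b', hb', rfl⟩)
    (P.mem_bruhatCell_mk m) with h | h
  · right
    obtain ⟨c, hc, k, hk, c', hc', e⟩ := P.mem_bruhatCell.1 h
    refine (QuotientGroup.eq.2 ?_).symm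
    rw [inv_one, one_mul]
    exact P.mem_parabolic.2 ⟨c, hc, k, hk ▸ hn, c', hc', e⟩
  · left
    -- as `s` commutes with `w`, the product lies in `BswB`, which is contained in `BsP_K`
    rw [← hcomm.eq] at h
    obtain ⟨c, hc, k, hk, c', hc', e⟩ := P.mem_bruhatCell.1 h
    refine ⟨c, hc, QuotientGroup.eq.2 ?_⟩
    refine P.mem_parabolic.2 ⟨1, one_mem _, m⁻¹ * k, ?_, c', hc', ?_⟩
    · rw [QuotientGroup.mk_mul, hk, QuotientGroup.mk_inv, inv_mul_cancel_left]
      exact hn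
    · rw [← e]
      push_cast
      group

/-- The commensurator of `P_K` contains the representatives of all products of elements of `S`
that commute with `K`. -/
theorem mem_commensurator (hB : IsCommensurated P.B) {K : Set P.S} {n : P.N}
    (hn : (QuotientGroup.mk n : P.Weyl) ∈ Subgroup.closure
      {s ∈ P.S | ∀ k ∈ (Subtype.val '' K : Set P.Weyl), Commute s k}) :
    (n : G) ∈ Subgroup.Commensurable.commensurator (P.parabolic K) := by
  have hpar := Subgroup.le_commensurator (P.parabolic K)
  have hle : Subgroup.closure {s ∈ P.S | ∀ k ∈ (Subtype.val '' K : Set P.Weyl), Commute s k} ≤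
      ((Subgroup.Commensurable.commensurator (P.parabolic K)).comap P.N.subtype).map
        (QuotientGroup.mk' (P.B.subgroupOf P.N)) := by
    refine (Subgroup.closure_le _).2 ?_
    rintro s ⟨hs, hsK⟩
    obtain ⟨m, rfl⟩ := QuotientGroup.mk_surjective s
    have hinv : (QuotientGroup.mk m⁻¹ : P.Weyl) = QuotientGroup.mk m := P.inv_eq_of_mem hs
    have h1 := P.relIndex_conj_parabolic_ne_zero hB hs hsK
    have h2 : (P.parabolic K).relIndex (ConjAct.toConjAct (m : G) • P.parabolic K) ≠ 0 := by
      rw [← inv_inv (m : G), Subgroup.relIndex_conj_inv, ← Subgroup.coe_inv]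
      refine P.relIndex_conj_parabolic_ne_zero hB ?_ ?_
      · rw [hinv]
        exact hs
      · rw [hinv]
        exact hsK
    have hm : (m : G) ∈ Subgroup.Commensurable.commensurator (P.parabolic K) := by
      rw [Subgroup.Commensurable.commensurator_mem_iff]
      exact ⟨h1, h2⟩
    exact Subgroup.mem_map.2 ⟨m, Subgroup.mem_comap.2 hm, rfl⟩
  obtain ⟨m, hm, e⟩ := Subgroup.mem_map.1 (hle hn)
  replace hm : (m : G) ∈ Subgroup.Commensurable.commensurator (P.parabolic K) :=
    Subgroup.mem_comap.1 hm
  have h1 : ((m⁻¹ * n : P.N) : G) ∈ P.B := Subgroup.mem_subgroupOf.1 (QuotientGroup.eq.1 e)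
  have h2 := mul_mem hm (hpar (P.B_le_parabolic K h1))
  simpa using h2

/-! ### Virtual containment of parabolic subgroups -/

theorem relIndex_of_weylClass_le {J J' : Set P.S} (h : P.weylClass J ≤ P.weylClass J') :
    (Subgroup.closure (Subtype.val '' J')).relIndex
      (Subgroup.closure (Subtype.val '' J : Set P.Weyl)) ≠ 0 :=
  StdParabolicModFinite.relIndex_ne_zero_of_transGen (.of J) (.of J') h

theorem weylClass_eq_iff {J J' : Set P.S} : P.weylClass J = P.weylClass J' ↔
    Subgroup.Commensurable (Subgroup.closure (Subtype.val '' J : Set P.Weyl))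
      (Subgroup.closure (Subtype.val '' J')) :=
  Quotient.eq (r := StdParabolic.setoid P.S)

theorem weylClass_mono {J J' : Set P.S} (h : J ⊆ J') : P.weylClass J ≤ P.weylClass J' :=
  .single ⟨_, _, rfl, rfl, Subgroup.closure_mono (Set.image_mono h)⟩

theorem exists_isRigid_weylClass_eq (hS : P.S.Finite) (J : Set P.S) :
    ∃ K ⊆ J, IsRigid (Subtype.val '' K : Set P.Weyl) ∧ P.weylClass K = P.weylClass J := by
  obtain ⟨K, hKJ, hrig, hidx⟩ := exists_isRigid (hS.subset (Subtype.coe_image_subset P.S J))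
  obtain ⟨K, hK, rfl⟩ := Set.subset_image_iff.1 hKJ
  refine ⟨K, hK, hrig, P.weylClass_eq_iff.2 ⟨hidx, ?_⟩⟩
  rw [Subgroup.relIndex_eq_one.2 (Subgroup.closure_mono hKJ)]
  exact one_ne_zero

theorem virtuallyContained_iff {A L : Subgroup G} : VirtuallyContained A L ↔ L.relIndex A ≠ 0 := by
  rw [VirtuallyContained, Subgroup.inf_subgroupOf_left, Subgroup.finiteIndex_iff]
  rfl

/-- For virtual containment of `gP_Jg⁻¹` in `P_J'`, the element `g` may be replaced by the middle
factor of its Bruhat decomposition, as `B` is contained in `P_J` and in `P_J'`. -/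
theorem relIndex_conj_of_eq_mul {J J' : Set P.S} {b n b' : G} (hb : b ∈ P.B) (hb' : b' ∈ P.B)
    (h : (P.parabolic J').relIndex (ConjAct.toConjAct (b * n * b') • P.parabolic J) ≠ 0) :
    (P.parabolic J').relIndex (ConjAct.toConjAct n • P.parabolic J) ≠ 0 := by
  have h1 := Subgroup.relIndex_conj b (ConjAct.toConjAct n • P.parabolic J) (P.parabolic J')
  rw [Subgroup.toConjAct_smul_eq_self (P.B_le_parabolic J' hb)] at h1
  rw [ConjAct.toConjAct_mul, ConjAct.toConjAct_mul, mul_smul, mul_smul,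
    Subgroup.toConjAct_smul_eq_self (P.B_le_parabolic J hb'), h1] at h
  exact h

theorem commensurable_parabolic (hB : IsCommensurated P.B) {J J' : Set P.S}
    (h : P.weylClass J = P.weylClass J') :
    Subgroup.Commensurable (P.parabolic J) (P.parabolic J') :=
  ⟨P.relIndex_parabolic_ne_zero hB (P.relIndex_of_weylClass_le h.ge),
    P.relIndex_parabolic_ne_zero hB (P.relIndex_of_weylClass_le h.le)⟩

theorem weylClass_le_of_relIndex_ne_zero (hS : P.S.Finite) {J J' : Set P.S} {g : G}
    (h : (P.parabolic J').relIndex (ConjAct.toConjAct g • P.parabolic J) ≠ 0) :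
    P.weylClass J ≤ P.weylClass J' := by
  obtain ⟨b, hb, n, b', hb', rfl⟩ := P.exists_eq_mul_mul g
  obtain ⟨K, hKJ, hrig, hK⟩ := P.exists_isRigid_weylClass_eq hS J
  have h1 := P.relIndex_weyl_ne_zero (P.relIndex_conj_of_eq_mul hb hb' h)
  have h2 := Subgroup.relIndex_ne_zero_mono_right h1
    (Subgroup.pointwise_smul_le_pointwise_smul_iff.2
      (Subgroup.closure_mono (Set.image_mono hKJ)))
  have h3 := (P.isFoldingSystem.subset_of_relIndex_conj_ne_zero (Subtype.coe_image_subset P.S K)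
    (Subtype.coe_image_subset P.S J') hrig h2).1
  rw [← hK]
  exact P.weylClass_mono ((Set.image_subset_image_iff Subtype.val_injective).1 h3)

/-- A conjugate of `P_J` that is virtually contained in `P_J` is commensurable with it: for the
rigid `K` with `[W_K] = [W_J]`, the conjugating element is in the commensurator of `P_K`. -/
theorem mem_commensurator_of_relIndex_ne_zero (hB : IsCommensurated P.B) (hS : P.S.Finite)
    {J : Set P.S} {g : G}
    (h : (P.parabolic J).relIndex (ConjAct.toConjAct g • P.parabolic J) ≠ 0) :
    g ∈ Subgroup.Commensurable.commensurator (P.parabolic J) := by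
  obtain ⟨K, hKJ, hrig, hK⟩ := P.exists_isRigid_weylClass_eq hS J
  have hKJ' := P.commensurable_parabolic hB hK
  rw [← Subgroup.Commensurable.eq hKJ']
  replace h : (P.parabolic K).relIndex (ConjAct.toConjAct g • P.parabolic K) ≠ 0 :=
    Subgroup.relIndex_ne_zero_trans hKJ'.1
      (Subgroup.relIndex_ne_zero_trans h (hKJ'.conj (ConjAct.toConjAct g)).2)
  have hpar := Subgroup.le_commensurator (P.parabolic K)
  obtain ⟨b, hb, n, b', hb', rfl⟩ := P.exists_eq_mul_mul g
  have h1 := P.relIndex_weyl_ne_zero (P.relIndex_conj_of_eq_mul hb hb' h)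
  obtain ⟨-, x, hx, c, hc, y, hy, e⟩ := P.isFoldingSystem.subset_of_relIndex_conj_ne_zero
    (Subtype.coe_image_subset P.S K) (Subtype.coe_image_subset P.S K) hrig h1
  obtain ⟨x, rfl⟩ := QuotientGroup.mk_surjective x
  obtain ⟨y, rfl⟩ := QuotientGroup.mk_surjective y
  have hx' := hpar (P.coe_mem_parabolic_iff.2 hx)
  have hy' := hpar (P.coe_mem_parabolic_iff.2 hy)
  have hc' : ((x⁻¹ * n * y⁻¹ : P.N) : G) ∈
      Subgroup.Commensurable.commensurator (P.parabolic K) := by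
    refine P.mem_commensurator hB ?_
    rw [QuotientGroup.mk_mul, QuotientGroup.mk_mul, e]
    convert hc using 1
    simp [mul_assoc]
  have hn : (n : G) ∈ Subgroup.Commensurable.commensurator (P.parabolic K) := by
    have := mul_mem (mul_mem hx' hc') hy'
    push_cast at this
    convert this using 1
    group
  exact mul_mem (mul_mem (hpar (P.B_le_parabolic K hb)) hn) (hpar (P.B_le_parabolic K hb'))

end BNPair

theorem mainTheorem5 {G : Type*} [Group G] (P : BNPair G) (hB : IsCommensurated P.B)
    (hS : P.S.Finite) (J J' : Set P.S) :
    (∀ g : G, VirtuallyContained (ConjAct.toConjAct g • P.parabolic J) (P.parabolic J') →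
      P.weylClass J ≤ P.weylClass J' ∧
        (P.weylClass J = P.weylClass J' ↔
          Subgroup.Commensurable (ConjAct.toConjAct g • P.parabolic J) (P.parabolic J'))) ∧
    (P.weylClass J ≤ P.weylClass J' →
      VirtuallyContained (P.parabolic J) (P.parabolic J')) := by
  refine ⟨fun g hg => ?_, fun h => BNPair.virtuallyContained_iff.2
    (P.relIndex_parabolic_ne_zero hB (P.relIndex_of_weylClass_le h))⟩
  rw [BNPair.virtuallyContained_iff] at hg
  have hle := P.weylClass_le_of_relIndex_ne_zero hS hg
  refine ⟨hle, fun heq => ?_, fun hcomm => hle.antisymm ?_⟩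
  · have h1 := P.commensurable_parabolic hB heq
    have h2 := P.mem_commensurator_of_relIndex_ne_zero hB hS
      (Subgroup.relIndex_ne_zero_trans h1.1 hg)
    exact ((Subgroup.Commensurable.commensurator_mem_iff _ _).1 h2).trans h1
  · have h1 := hcomm.1
    rw [← Subgroup.relIndex_conj_inv] at h1
    exact P.weylClass_le_of_relIndex_ne_zero hS h1
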